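/- For a topological space $X$, a cellular family in $X$ is a family of pairwise disjoint nonempty open subsets of $X$, and the Souslin number $S(X)$ is the least cardinal $\mu$ such that no cellular family in $X$ has cardinality $\mu$ (finite values are allowed). For an infinite cardinal $\kappa$ and topological spaces $X_i$ $(i\in I)$, write $X_I=\prod_{i\in I}X_i$, and let $(X_I)_\kappa$ be $X_I$ with the $\kappa$-box topology, that is, the topology having as a base the sets $\prod_{i\in I}U_i$ with each $U_i$ open in $X_i$ and $|\{i\in I:U_i\neq X_i\}|<\kappa$. Write $\alpha^{<\kappa}=\sum_{\lambda<\kappa}\alpha^\lambda$, the sum being over cardinals $\lambda<\kappa$, and $[I]^{<\lambda}=\{J\subseteq I:|J|<\lambda\}$. **Theorem.** Let $\alpha\ge 2$ and $\kappa\ge\omega$ be cardinals such that $\alpha^{<\kappa}<(\alpha^{<\kappa})^{<\kappa}$, and let $\{X_i:i\in I\}$ be a set of nonempty topological spaces (no separation axioms are assumed). (1) If $S((X_I)_\kappa)>(\alpha^{<\kappa})^+$, then there are an infinite cardinal $\lambda<\kappa$ and a set $J\in[I]^{<\lambda}$ such that $S((X_J)_\lambda)\ge(\alpha^{<\kappa})^+$.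 (2) Consequently, if $S((X_J)_\kappa)<(\alpha^{<\kappa})^+$ for every nonempty $J\in[I]^{<\kappa}$, then $S((X_I)_\kappa)\le(\alpha^{<\kappa})^+$. -/

import Mathlib

open scoped Cardinal

universe u

/-- A cellular family in the space `(X, t)`: a family of pairwise disjoint nonempty open sets. -/
def IsCellular {X : Type u} (t : TopologicalSpace X) (A : Set (Set X)) : Prop :=
  (∀ U ∈ A, @IsOpen X t U ∧ U.Nonempty) ∧ A.PairwiseDisjoint id

/-- The Souslin number of the space `(X, t)`: the least cardinal `μ` such that no cellular family
has cardinality exactly `μ`. (Finite values are allowed; the set of such `μ` is never empty, as it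
contains every cardinal larger than the power set of `X`.) -/
noncomputable def souslinNumber {X : Type u} (t : TopologicalSpace X) : Cardinal.{u} :=
  sInf {μ : Cardinal.{u} | ¬ ∃ A : Set (Set X), IsCellular t A ∧ #A = μ}

/-- The canonical open sets of the `κ`-box topology: the products `∏ i, U i` of open sets
with `U i ≠ X i` for fewer than `κ` many indices `i`. -/
def canonicalBoxes {I : Type u} (X : I → Type u) [∀ i, TopologicalSpace (X i)]
    (κ : Cardinal.{u}) : Set (Set (∀ i, X i)) :=
  {B | ∃ U : ∀ i, Set (X i), (∀ i, IsOpen (U i)) ∧ #{i : I | U i ≠ Set.univ} < κ ∧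
    B = Set.univ.pi U}

/-- The `κ`-box topology on the product `∏ i, X i`. For infinite `κ` the canonical open sets
form a base of it, see `isTopologicalBasis_canonicalBoxes`. -/
@[reducible] def boxTopology {I : Type u} (X : I → Type u) [∀ i, TopologicalSpace (X i)]
    (κ : Cardinal.{u}) : TopologicalSpace (∀ i, X i) :=
  TopologicalSpace.generateFrom (canonicalBoxes X κ)

theorem isTopologicalBasis_canonicalBoxes {I : Type u} (X : I → Type u)
    [∀ i, TopologicalSpace (X i)] (κ : Cardinal.{u}) (hκ : ℵ₀ ≤ κ) :
    @TopologicalSpace.IsTopologicalBasis _ (boxTopology X κ) (canonicalBoxes X κ) := by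
  refine @TopologicalSpace.IsTopologicalBasis.mk _ (boxTopology X κ) _ ?_ ?_ rfl
  · rintro _ ⟨U, hU, hUκ, rfl⟩ _ ⟨V, hV, hVκ, rfl⟩ x hx
    refine ⟨_, ⟨fun i => U i ∩ V i, fun i => (hU i).inter (hV i), ?_, rfl⟩, ?_, ?_⟩
    · refine lt_of_le_of_lt ((Cardinal.mk_le_mk_of_subset ?_).trans
        (Cardinal.mk_union_le {i | U i ≠ Set.univ} {i | V i ≠ Set.univ}))
        (Cardinal.add_lt_of_lt hκ hUκ hVκ)
      intro i hi
      by_contra hcon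
      simp only [Set.mem_union, Set.mem_ofPred_eq, not_or, not_not] at hcon
      exact hi (by simp [hcon.1, hcon.2])
    · rw [Set.pi_inter_distrib]
      exact hx
    · rw [Set.pi_inter_distrib]
  · refine Set.eq_univ_of_univ_subset (Set.subset_sUnion_of_mem ?_)
    refine ⟨fun _ => Set.univ, fun _ => isOpen_univ, ?_, by simp⟩
    have h0 : (0 : Cardinal.{u}) < κ := lt_of_lt_of_le Cardinal.aleph0_pos hκ
    simpa using h0

section

open Cardinal Ordinal Topology

/-! Write β = α^{<κ}. The hypothesis β < β^{<κ} forces κ to be singular and α^ν < β for all ν < κ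
(`isSingular_of_powerlt_lt`, `power_lt_powerlt`), so β is a limit of fewer than κ powers of α.

Shrink β⁺ pairwise disjoint open sets to boxes. By pigeonhole, β⁺ of these have supports of size at
most one ν < κ. For each ρ in a cofinal set of powers below β with ρ^ν = ρ,
`exists_small_separating_set` gives at most ν coordinates that already separate more than ρ boxes.
The union J of these coordinate sets still has size at most ν, so X_J in the ν⁺-box topology has
cellular families of every size below β. Erdős–Tarski (`HasCellularFamily.of_forall_lt`) then yields
one of size β. Part (2) follows because the κ-box topology on X_J is finer. -/

/-! ### Cardinal arithmetic of weak powers -/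

theorem Cardinal.le_powerlt_self {α κ : Cardinal.{u}} (hα : 2 ≤ α) : κ ≤ α ^< κ := by
  refine le_of_forall_lt fun ν hν => ?_
  exact ((cantor ν).trans_le (power_le_power_right hα)).trans_le (le_powerlt α hν)

theorem Cardinal.exists_lt_power_of_lt_powerlt {α κ μ : Cardinal.{u}} (h : μ < α ^< κ) :
    ∃ ν < κ, μ < α ^ ν := by
  by_contra! hcon
  exact h.not_ge (powerlt_le.2 hcon)

theorem Cardinal.mk_Iio_toType_lt {κ : Cardinal.{u}} (k : κ.ord.ToType) : #(Set.Iio k) < κ := by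
  simpa using mk_Iio_lt k (by simp)

theorem Cardinal.exists_mk_Iio_toType {κ ν : Cardinal.{u}} (h : ν < κ) :
    ∃ k : κ.ord.ToType, #(Set.Iio k) = ν := by
  have h' : ν.ord < typeLT κ.ord.ToType := by simpa using h
  obtain ⟨k, hk⟩ := typein_surj (α := κ.ord.ToType) (· < ·) h'
  refine ⟨k, ?_⟩
  rw [← card_ord ν, ← hk]
  rfl

/-- By regularity, a function from μ < κ into β takes all its values below a single α^ν with ν < κ.
For each such ν there are at most α^(ν·μ) ≤ β functions, and there are only κ ≤ β levels. -/
theorem Cardinal.IsRegular.powerlt_powerlt_le {α κ : Cardinal.{u}} (hα : 2 ≤ α)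
    (hκ : κ.IsRegular) : (α ^< κ) ^< κ ≤ α ^< κ := by
  have hα0 : α ≠ 0 := (two_pos.trans_le hα).ne'
  refine powerlt_le.2 fun μ hμ => ?_
  set β := α ^< κ with hβ
  have hβκ : κ ≤ β := le_powerlt_self hα
  let B := β.ord.ToType
  let K := κ.ord.ToType
  let M := μ.out
  let level : K → Set B := fun k => {b | #(Set.Iio b) < α ^ #(Set.Iio k)}
  have hlevel : ∀ k, #(level k) ≤ α ^ #(Set.Iio k) := by
    intro k
    let σ := α ^ #(Set.Iio k)
    have : ∀ b : level k, ∃ c : σ.ord.ToType,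
        typein (α := σ.ord.ToType) (· < ·) c = typein (α := B) (· < ·) b.1 := by
      intro b
      apply typein_surj
      rw [type_toType, lt_ord]
      exact b.2
    choose g hg using this
    have hinj : Function.Injective g := by
      intro b c hbc
      apply Subtype.ext
      apply typein_injective (α := B) (· < ·)
      rw [← hg, ← hg, hbc]
    simpa using mk_le_of_injective hinj
  have hIio : ∀ k : K, #(Set.Iio k) < κ := fun k => mk_Iio_toType_lt k
  have hcover : ∀ f : M → B, ∃ k : K, ∀ a, f a ∈ level k := by
    intro f
    have h1 : ∀ a, ∃ ν < κ, #(Set.Iio (f a)) < α ^ ν := fun a =>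
      exists_lt_power_of_lt_powerlt (mk_Iio_toType_lt (f a))
    choose ν hν hf using h1
    have hsup : ⨆ a, ν a < κ := iSup_lt_of_lt_cof_ord (by simpa [M, hκ.cof_ord] using hμ) hν
    obtain ⟨k, hk⟩ := exists_mk_Iio_toType hsup
    refine ⟨k, fun a => (hf a).trans_le ?_⟩
    rw [hk]
    exact power_le_power_left hα0 (le_ciSup bddAbove_of_small a)
  choose k hk using hcover
  let g : (M → B) → Σ k : K, (M → level k) := fun f => ⟨k f, fun a => ⟨f a, hk f a⟩⟩
  have hg : Function.Injective g := by
    refine Function.LeftInverse.injective (g := fun x a => (x.2 a).1) ?_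
    intro f
    rfl
  calc β ^ μ = #(M → B) := by simp [M, B]
    _ ≤ #(Σ k : K, (M → level k)) := mk_le_of_injective hg
    _ = Cardinal.sum fun k : K => #(level k) ^ μ := by
      rw [mk_sigma]; simp [M]
    _ ≤ Cardinal.sum fun _ : K => β := by
      refine sum_le_sum _ _ fun k => ?_
      refine (power_le_power_right (hlevel k)).trans ?_
      rw [← power_mul]
      exact le_powerlt α (mul_lt_of_lt hκ.aleph0_le (hIio k) hμ)
    _ = κ * β := by simp [K]
    _ ≤ β := by
      rw [mul_eq_right (hκ.aleph0_le.trans hβκ) hβκ hκ.pos.ne']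

theorem Cardinal.isSingular_of_powerlt_lt {α κ : Cardinal.{u}} (hα : 2 ≤ α) (hκ : ℵ₀ ≤ κ)
    (h : α ^< κ < (α ^< κ) ^< κ) : κ.IsSingular :=
  .of_not_isRegular hκ fun hr => h.not_ge (hr.powerlt_powerlt_le hα)

/-- If β ≤ α^ν with ν < κ, then β^μ ≤ α^(ν·μ) ≤ β for all μ < κ, against the hypothesis. -/
theorem Cardinal.power_lt_powerlt {α κ ν : Cardinal.{u}} (hκ : ℵ₀ ≤ κ)
    (h : α ^< κ < (α ^< κ) ^< κ) (hν : ν < κ) : α ^ ν < α ^< κ := by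
  by_contra! hcon
  refine h.not_ge (powerlt_le.2 fun μ hμ => (power_le_power_right hcon).trans ?_)
  rw [← power_mul]
  exact le_powerlt α (mul_lt_of_lt hκ hν hμ)

theorem Cardinal.IsSingular.exists_cofinal {κ : Cardinal.{u}} (h : κ.IsSingular) :
    ∃ (Γ : Type u) (c : Γ → Cardinal.{u}), #Γ < κ ∧ (∀ γ, c γ < κ) ∧ ∀ μ < κ, ∃ γ, μ < c γ := by
  obtain ⟨s, hs, hsc⟩ := Order.exists_cof_eq κ.ord.ToType
  rw [cof_toType] at hsc
  refine ⟨s, fun γ => #(Set.Iio γ.1), hsc ▸ h.cof_ord_lt, fun γ => mk_Iio_toType_lt _,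
    fun μ hμ => ?_⟩
  obtain ⟨k, hk⟩ := exists_mk_Iio_toType (h.isSuccLimit.succ_lt hμ)
  obtain ⟨γ, hγ, hkγ⟩ := hs k
  refine ⟨⟨γ, hγ⟩, (Order.lt_succ μ).trans_le ?_⟩
  rw [← hk]
  exact mk_le_mk_of_subset (Set.Iio_subset_Iio hkγ)

/-! ### Closure under infinitary operations -/

/-- Closing off under an operation on the subsets of size at most `ν`. -/
theorem Cardinal.exists_closed_set {I : Type u} {ν ρ : Cardinal.{u}} (hρ : ℵ₀ ≤ ρ)
    (hνρ : ρ ^ ν ≤ ρ) (F : Set I → Set I) (hF : ∀ J : Set I, #J ≤ ν → #(F J) ≤ ρ) :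
    ∃ A : Set I, #A ≤ ρ ∧ ∀ J ⊆ A, #J ≤ ν → F J ⊆ A := by
  classical
  -- The closure consists of the values of well-founded terms: a leaf `none`, and ρ operations of
  -- arity ν, the p-th picking the p-th element of `F J`. Since ρ^ν ≤ ρ, there are at most ρ terms.
  let arity : Option ρ.out → Type u := fun o => o.elim PEmpty fun _ => ν.out
  have hcard : #(WType arity) ≤ ρ := by
    refine WType.cardinalMk_le_of_le ?_
    calc _ ≤ Cardinal.sum fun _ : Option ρ.out => ρ := by
          refine sum_le_sum _ _ fun a => ?_
          cases a with
          | none => simpa [arity] using one_le_aleph0.trans hρ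
          | some a => simpa [arity] using hνρ
      _ ≤ ρ := by simp [add_one_eq hρ, mul_eq_self hρ]
  have hen : ∀ J : Set I, ∃ e : ρ.out → Option I, #J ≤ ν → ∀ i ∈ F J, ∃ p, e p = some i := by
    intro J
    by_cases hJ : #J ≤ ν
    · obtain ⟨g⟩ : Nonempty (F J ↪ ρ.out) := by
        rw [← Cardinal.le_def]
        simpa using hF J hJ
      exact ⟨Function.extend g (fun i => some i.1) fun _ => none,
        fun _ i hi => ⟨g ⟨i, hi⟩, g.injective.extend_apply _ _ _⟩⟩
    · exact ⟨fun _ => none, fun h => absurd h hJ⟩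
  choose e he using hen
  let step : (Σ o, arity o → Option I) → Option I := fun x =>
    match x with
    | ⟨none, _⟩ => none
    | ⟨some p, f⟩ => e {i | ∃ a, f a = some i} p
  let ev : WType arity → Option I := WType.elim (Option I) step
  let base : WType arity := ⟨none, PEmpty.elim⟩
  have hbase : ev base = none := rfl
  refine ⟨{i | ∃ w, ev w = some i}, ?_, ?_⟩
  · refine le_trans ?_ hcard
    have h : ∀ i : {i | ∃ w, ev w = some i}, ∃ w, ev w = some i.1 := fun i => i.2
    choose w hw using h
    refine mk_le_of_injective (f := w) fun i j hij => Subtype.ext ?_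
    exact Option.some_injective _ (by rw [← hw, ← hw, hij])
  · intro J hJ hJν i hi
    obtain ⟨p, hp⟩ := he J hJν i hi
    obtain ⟨g⟩ : Nonempty (J ↪ ν.out) := by
      rw [← Cardinal.le_def]
      simpa using hJν
    have h : ∀ j : J, ∃ w, ev w = some j.1 := fun j => hJ j.2
    choose w hw using h
    -- Unused argument places receive the leaf, whose value `none` adds nothing to J.
    let f : ν.out → WType arity := Function.extend g w fun _ => base
    have hf : {i | ∃ a, ev (f a) = some i} = J := by
      ext j
      constructor
      · rintro ⟨a, ha⟩
        by_cases hag : ∃ j, g j = a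
        · obtain ⟨j', rfl⟩ := hag
          rw [show f (g j') = w j' from g.injective.extend_apply _ _ _, hw] at ha
          exact Option.some_injective _ ha ▸ j'.2
        · rw [show f a = base from Function.extend_apply' _ _ _ hag, hbase] at ha
          simp at ha
      · intro hj
        refine ⟨g ⟨j, hj⟩, ?_⟩
        rw [show f (g ⟨j, hj⟩) = w ⟨j, hj⟩ from g.injective.extend_apply _ _ _, hw]
    refine ⟨⟨some p, f⟩, ?_⟩
    change e {i | ∃ a, ev (f a) = some i} p = some i
    rw [hf, hp]

/-! ### Cellular families and the Erdős–Tarski theorem -/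

/-- The open set `V` contains a cellular family with at least `μ` members. -/
def HasCellularFamily {X : Type u} (t : TopologicalSpace X) (V : Set X) (μ : Cardinal.{u}) :
    Prop :=
  ∃ A, IsCellular t A ∧ (∀ U ∈ A, U ⊆ V) ∧ μ ≤ #A

section

variable {X : Type u} {t : TopologicalSpace X}

theorem IsCellular.subset {A B : Set (Set X)} (hA : IsCellular t A) (h : B ⊆ A) :
    IsCellular t B :=
  ⟨fun U hU => hA.1 U (h hU), hA.2.subset h⟩

theorem HasCellularFamily.mono {V : Set X} {μ ν : Cardinal.{u}} (h : HasCellularFamily t V ν)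
    (hμ : μ ≤ ν) : HasCellularFamily t V μ := by
  obtain ⟨A, hA, hV, hc⟩ := h
  exact ⟨A, hA, hV, hμ.trans hc⟩

theorem HasCellularFamily.of_le {V : Set X} {t' : TopologicalSpace X} {μ : Cardinal.{u}}
    (h : HasCellularFamily t V μ) (ht : t' ≤ t) : HasCellularFamily t' V μ := by
  obtain ⟨A, hA, hV, hc⟩ := h
  exact ⟨A, ⟨fun U hU => ⟨ht U (hA.1 U hU).1, (hA.1 U hU).2⟩, hA.2⟩, hV, hc⟩

theorem hasCellularFamily_zero (V : Set X) : HasCellularFamily t V 0 :=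
  ⟨∅, ⟨by simp, by simp⟩, by simp, by simp⟩

theorem HasCellularFamily.of_pairwise {Ξ : Type u} (U : Ξ → Set X) {V : Set X}
    (hU : ∀ ξ, IsOpen[t] (U ξ)) (hne : ∀ ξ, (U ξ).Nonempty) (hV : ∀ ξ, U ξ ⊆ V)
    (hd : Pairwise fun ξ η => Disjoint (U ξ) (U η)) : HasCellularFamily t V #Ξ := by
  have hinj : Function.Injective U := by
    intro ξ η h
    by_contra hne'
    have : Disjoint (U ξ) (U η) := hd hne'
    rw [h, disjoint_self] at this
    exact (hne η).ne_empty this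
  refine ⟨Set.range U, ⟨?_, ?_⟩, ?_, (mk_range_eq U hinj).ge⟩
  · rintro _ ⟨ξ, rfl⟩
    exact ⟨hU ξ, hne ξ⟩
  · rintro _ ⟨ξ, rfl⟩ _ ⟨η, rfl⟩ h
    exact hd fun h' => h (by rw [h'])
  · rintro _ ⟨ξ, rfl⟩
    exact hV ξ

theorem IsCellular.hasCellularFamily_sum {F : Set (Set X)} (hF : IsCellular t F) {W : Set X}
    (hW : ∀ V ∈ F, V ⊆ W) (τ : F → Cardinal.{u})
    (h : ∀ V : F, HasCellularFamily t V.1 (τ V)) :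
    HasCellularFamily t W (Cardinal.sum τ) := by
  choose A hA hsub hcard using h
  have key := HasCellularFamily.of_pairwise (t := t) (V := W)
    (fun x : Σ V : F, A V => x.2.1) (fun x => ((hA x.1).1 _ x.2.2).1)
    (fun x => ((hA x.1).1 _ x.2.2).2)
    (fun x => (hsub x.1 _ x.2.2).trans (hW _ x.1.2)) ?_
  · refine key.mono ?_
    rw [mk_sigma]
    exact sum_le_sum _ _ hcard
  · rintro ⟨V, U⟩ ⟨V', U'⟩ hne
    by_cases hVV : V = V'
    · subst hVV
      refine (hA V).2 U.2 U'.2 fun h => hne ?_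
      rw [Subtype.ext h]
    · exact (hF.2 V.2 V'.2 fun h => hVV (Subtype.ext h)).mono (hsub V _ U.2) (hsub V' _ U'.2)

/-- The sizes `b γ` are distributed over distinct members of a disjoint family indexed by Γ. -/
theorem HasCellularFamily.of_cofinal {β : Cardinal.{u}} {Γ : Type u} {b : Γ → Cardinal.{u}}
    (hb : ∀ γ, b γ < β) (hcof : ∀ μ < β, ∃ γ, μ < b γ) {W : Set X}
    (hΓ : HasCellularFamily t W #Γ)
    (h : ∀ V ⊆ W, IsOpen[t] V → V.Nonempty → ∀ μ < β, HasCellularFamily t V μ) :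
    HasCellularFamily t W β := by
  obtain ⟨F, hF, hFW, ⟨g⟩⟩ := hΓ
  have hβ : ∀ V : F, Function.extend g b (fun _ => 0) V = 0 ∨
      Function.extend g b (fun _ => 0) V < β := by
    intro V
    by_cases hV : ∃ γ, g γ = V
    · obtain ⟨γ, rfl⟩ := hV
      right
      rw [g.injective.extend_apply]
      exact hb γ
    · left
      exact Function.extend_apply' _ _ _ hV
  refine (hF.hasCellularFamily_sum hFW (Function.extend g b fun _ => 0) fun V => ?_).mono ?_
  · rcases hβ V with h0 | hlt
    · rw [h0]
      exact hasCellularFamily_zero _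
    · exact h V (hFW _ V.2) (hF.1 _ V.2).1 (hF.1 _ V.2).2 _ hlt
  · refine le_of_forall_lt fun μ hμ => ?_
    obtain ⟨γ, hγ⟩ := hcof μ hμ
    refine hγ.trans_le ?_
    have := le_sum (Function.extend g b fun _ => 0) (g γ)
    rwa [g.injective.extend_apply] at this

/-- Cellular families inside the members of a maximal cellular family bound all others. -/
theorem IsCellular.mk_le_of_maximal {F A : Set (Set X)} (hF : ∀ V ∈ F, IsOpen[t] V)
    (hA : IsCellular t A) (hmeet : ∀ U ∈ A, ∃ V ∈ F, (U ∩ V).Nonempty) {μ : Cardinal.{u}}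
    (hμ : ℵ₀ ≤ μ) (hFμ : #F ≤ μ) (hs : ∀ V ∈ F, ∀ ν, HasCellularFamily t V ν → ν ≤ μ) :
    #A ≤ μ := by
  have h1 : A ⊆ ⋃ V : F, {U ∈ A | (U ∩ V.1).Nonempty} := by
    intro U hU
    obtain ⟨V, hV, hUV⟩ := hmeet U hU
    exact Set.mem_iUnion.2 ⟨⟨V, hV⟩, hU, hUV⟩
  have h2 : ∀ V : F, #({U ∈ A | (U ∩ V.1).Nonempty} : Set (Set X)) ≤ μ := by
    intro V
    refine hs V V.2 _ (HasCellularFamily.of_pairwise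
      (fun U : ({U ∈ A | (U ∩ V.1).Nonempty} : Set (Set X)) => U.1 ∩ V.1)
      (fun U => @IsOpen.inter X t _ _ (hA.1 _ U.2.1).1 (hF V V.2)) (fun U => U.2.2)
      (fun U => Set.inter_subset_right) ?_)
    intro U U' hne
    exact (hA.2 U.2.1 U'.2.1 fun h => hne (Subtype.ext h)).mono Set.inter_subset_left
      Set.inter_subset_left
  calc #A ≤ _ := mk_le_mk_of_subset h1
    _ ≤ _ := mk_iUnion_le_sum_mk
    _ ≤ Cardinal.sum fun _ : F => μ := sum_le_sum _ _ h2
    _ = #F * μ := by simp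
    _ ≤ μ * μ := mul_le_mul_left hFμ μ
    _ = μ := mul_eq_self hμ

theorem exists_maximal_cellular (p : Set X → Prop)
    (hp : ∀ U, IsOpen[t] U → U.Nonempty → ∃ V ⊆ U, IsOpen[t] V ∧ V.Nonempty ∧ p V) :
    ∃ F, IsCellular t F ∧ (∀ V ∈ F, p V) ∧
      ∀ U, IsOpen[t] U → U.Nonempty → ∃ V ∈ F, (U ∩ V).Nonempty := by
  obtain ⟨F, hF⟩ := zorn_subset {F | IsCellular t F ∧ ∀ V ∈ F, p V} (by
    intro c hc hchain
    refine ⟨⋃₀ c, ⟨⟨?_, ?_⟩, ?_⟩, fun s hs => Set.subset_sUnion_of_mem hs⟩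
    · rintro U ⟨s, hs, hU⟩
      exact (hc hs).1.1 U hU
    · exact (Set.pairwiseDisjoint_sUnion hchain.directedOn).2 fun s hs => (hc hs).1.2
    · rintro U ⟨s, hs, hU⟩
      exact (hc hs).2 U hU)
  refine ⟨F, hF.prop.1, hF.prop.2, fun U hU hne => ?_⟩
  by_contra! hcon
  obtain ⟨V, hVU, hV, hVne, hpV⟩ := hp U hU hne
  have hVF : ∀ W ∈ F, Disjoint V W := fun W hW =>
    (Set.disjoint_iff_inter_eq_empty.2 (hcon W hW)).mono_left hVU
  have hins : insert V F ∈ {F | IsCellular t F ∧ ∀ V ∈ F, p V} := by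
    refine ⟨⟨?_, ?_⟩, ?_⟩
    · rintro W (rfl | hW)
      exacts [⟨hV, hVne⟩, hF.prop.1.1 W hW]
    · exact hF.prop.1.2.insert fun W hW _ => hVF W hW
    · rintro W (rfl | hW)
      exacts [hpV, hF.prop.2 W hW]
  have hmem : V ∈ F := hF.le_of_ge hins (Set.subset_insert V F) (Set.mem_insert V F)
  have := hVF V hmem
  rw [disjoint_self] at this
  exact hVne.ne_empty this

/-- The Erdős–Tarski theorem: the supremum of the sizes of cellular families is attained when
it is a singular cardinal. -/
theorem HasCellularFamily.of_forall_lt {β : Cardinal.{u}} (hβ : ℵ₀ < β) {Γ : Type u}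
    {b : Γ → Cardinal.{u}} (hΓ : #Γ < β) (hb : ∀ γ, b γ < β) (hcof : ∀ μ < β, ∃ γ, μ < b γ)
    (h : ∀ μ < β, HasCellularFamily t Set.univ μ) : HasCellularFamily t Set.univ β := by
  classical
  -- Either some U is homogeneous for sizes below β, or the open sets missing some size below β are
  -- dense, and a maximal disjoint family F of them exists.
  by_cases hU : ∃ U, IsOpen[t] U ∧ U.Nonempty ∧
      ∀ V ⊆ U, IsOpen[t] V → V.Nonempty → ∀ μ < β, HasCellularFamily t V μ
  · obtain ⟨U, hUo, hUne, hUall⟩ := hU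
    obtain ⟨A, hA, -, hc⟩ :=
      HasCellularFamily.of_cofinal hb hcof (hUall U subset_rfl hUo hUne _ hΓ) hUall
    exact ⟨A, hA, fun _ _ => Set.subset_univ _, hc⟩
  push Not at hU
  obtain ⟨F, hF, hsmall, hmeet⟩ :=
    exists_maximal_cellular (t := t) (fun V => ∃ μ < β, ¬ HasCellularFamily t V μ) hU
  by_cases hFβ : β ≤ #F
  · exact ⟨F, hF, fun _ _ => Set.subset_univ _, hFβ⟩
  push Not at hFβ
  let s : Set X → Cardinal.{u} := fun V => sInf {μ | ¬ HasCellularFamily t V μ}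
  have hs1 : ∀ V ∈ F, ∀ ν, HasCellularFamily t V ν → ν < s V := by
    intro V hV ν hν
    obtain ⟨μ, -, hμ⟩ := hsmall V hV
    by_contra! hcon
    exact csInf_mem (s := {μ | ¬ HasCellularFamily t V μ}) ⟨μ, hμ⟩ (hν.mono hcon)
  have hs2 : ∀ V, ∀ ν < s V, HasCellularFamily t V ν := fun V ν hν => by
    by_contra hcon
    exact notMem_of_lt_csInf' hν hcon
  have hsβ : ∀ V ∈ F, s V < β := by
    intro V hV
    obtain ⟨μ, hμβ, hμ⟩ := hsmall V hV
    exact (csInf_le' hμ).trans_lt hμβ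
  have hunb : ∀ σ < β, ∃ V ∈ F, σ < s V := by
    intro σ hσ
    by_contra! hcon
    obtain ⟨γ, hγ⟩ := hcof (max σ (max #F ℵ₀)) (max_lt hσ (max_lt hFβ hβ))
    obtain ⟨A, hA, -, hAc⟩ := h _ (hb γ)
    refine (hγ.trans_le hAc).not_ge (hA.mk_le_of_maximal (fun V hV => (hF.1 V hV).1)
      (fun U hUA => hmeet U (hA.1 U hUA).1 (hA.1 U hUA).2) ?_ ?_ fun V hV ν hν => ?_)
    · exact (le_max_right _ _).trans (le_max_right _ _)
    · exact (le_max_left _ _).trans (le_max_right _ _)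
    · exact ((hs1 V hV ν hν).le.trans (hcon V hV)).trans (le_max_left _ _)
  -- The size `s V` itself need not be attained inside V, but it is attained inside a member with
  -- the next larger value of s.
  have hnext : ∀ V : F, ∃ W : F, s V < s W ∧ ∀ W' : F, s V < s W' → s W ≤ s W' := by
    intro V
    obtain ⟨W, hW, hVW⟩ := hunb _ (hsβ V V.2)
    obtain ⟨W₀, h₀, hmin⟩ := (InvImage.wf (fun W : F => s W) Cardinal.lt_wf).has_min
      {W : F | s V < s W} ⟨⟨W, hW⟩, hVW⟩
    exact ⟨W₀, h₀, fun W' hW' => not_lt.1 (hmin W' hW')⟩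
  choose N hN hNmin using hnext
  let τ : F → Cardinal.{u} := fun W => if h : ∃ V, N V = W then s h.choose.1 else 0
  refine (hF.hasCellularFamily_sum (fun _ _ => Set.subset_univ _) τ fun W => ?_).mono ?_
  · by_cases hW : ∃ V, N V = W
    · simp only [τ, dif_pos hW]
      apply hs2
      conv_rhs => rw [← hW.choose_spec]
      exact hN _
    · simp only [τ, dif_neg hW]
      exact hasCellularFamily_zero _
  · by_contra! hcon
    obtain ⟨V, hV, hlt⟩ := hunb _ hcon
    have hW : ∃ V', N V' = N ⟨V, hV⟩ := ⟨_, rfl⟩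
    have h1 : τ (N ⟨V, hV⟩) = s hW.choose.1 := dif_pos hW
    have h2 := hW.choose_spec
    -- Members with the same successor have the same s, so the chosen preimage loses nothing.
    have h3 : s V ≤ s hW.choose.1 := by
      by_contra! h4
      have h5 := hNmin _ ⟨V, hV⟩ h4
      rw [h2] at h5
      exact (hN ⟨V, hV⟩).not_ge h5
    exact hlt.not_ge (h3.trans (h1 ▸ le_sum τ _))

theorem HasCellularFamily.succ_le_souslinNumber {β : Cardinal.{u}}
    (h : HasCellularFamily t Set.univ β) : Order.succ β ≤ souslinNumber t := by
  refine le_csInf ⟨Order.succ #(Set X), ?_⟩ fun μ hμ => ?_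
  · rintro ⟨A, -, hA⟩
    exact (Order.lt_succ #(Set X)).not_ge (hA ▸ mk_set_le A)
  · by_contra! hlt
    obtain ⟨A, hA, -, hc⟩ := h
    obtain ⟨B, hBA, hB⟩ := le_mk_iff_exists_subset.1 ((Order.lt_succ_iff.1 hlt).trans hc)
    exact hμ ⟨B, hA.subset hBA, hB⟩

theorem exists_isCellular_of_lt_souslinNumber {μ : Cardinal.{u}} (h : μ < souslinNumber t) :
    ∃ A, IsCellular t A ∧ #A = μ := by
  by_contra hcon
  exact notMem_of_lt_csInf' h hcon

theorem HasCellularFamily.le_one [Subsingleton X] {V : Set X} {μ : Cardinal.{u}}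
    (h : HasCellularFamily t V μ) : μ ≤ 1 := by
  obtain ⟨A, hA, -, hc⟩ := h
  refine hc.trans (le_one_iff_subsingleton.2 ⟨fun U U' => Subtype.ext ?_⟩)
  rw [Subsingleton.eq_univ_of_nonempty (hA.1 _ U.2).2,
    Subsingleton.eq_univ_of_nonempty (hA.1 _ U'.2).2]

end

/-! ### Separation by few coordinates -/

/-- If more than `ρ` objects, each with support of size at most `ν`, are pairwise separated by
coordinates in the intersection of their supports, then more than `ρ` of them are pairwise
separated by the coordinates in a single set of size at most `ν`. -/
theorem exists_small_separating_set {I Ξ : Type u} (R : Ξ → Set I) (D : I → Ξ → Ξ → Prop)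
    (hsymm : ∀ i ξ η, D i ξ η → D i η ξ) (hDR : ∀ i ξ η, D i ξ η → i ∈ R ξ)
    (hD : ∀ ξ η, ξ ≠ η → ∃ i, D i ξ η) {ν ρ : Cardinal.{u}} (hρ : ℵ₀ ≤ ρ) (hνρ : ρ ^ ν ≤ ρ)
    (hR : ∀ ξ, #(R ξ) ≤ ν) (hΞ : ρ < #Ξ) :
    ∃ (J : Set I) (T : Set Ξ), #J ≤ ν ∧ ρ < #T ∧ T.Pairwise fun ξ η => ∃ i ∈ J, D i ξ η := by
  by_contra! hcon
  have hν : ν ≤ ρ := (cantor ν).le.trans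
    ((power_le_power_right ((natCast_lt_aleph0 (n := 2)).le.trans hρ)).trans hνρ)
  have hmax : ∀ J : Set I, ∃ T : Set Ξ, (T.Pairwise fun ξ η => ∃ i ∈ J, D i ξ η) ∧
      ∀ η, (∀ ξ ∈ T, ξ ≠ η → ∃ i ∈ J, D i ξ η) → η ∈ T := by
    intro J
    obtain ⟨T, hT⟩ := zorn_subset {T : Set Ξ | T.Pairwise fun ξ η => ∃ i ∈ J, D i ξ η}
      fun c hc hchain => ⟨⋃₀ c, (Set.pairwise_sUnion hchain.directedOn).2 fun s hs => hc hs,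
        fun s hs => Set.subset_sUnion_of_mem hs⟩
    refine ⟨T, hT.prop, fun η hη => ?_⟩
    refine hT.le_of_ge ?_ (Set.subset_insert η T) (Set.mem_insert η T)
    refine Set.Pairwise.insert hT.prop fun ξ hξ hne => ?_
    obtain ⟨i, hi, hd⟩ := hη ξ hξ hne.symm
    exact ⟨⟨i, hi, hsymm _ _ _ hd⟩, ⟨i, hi, hd⟩⟩
  choose T hT hTmax using hmax
  have hTcard : ∀ J : Set I, #J ≤ ν → #(T J) ≤ ρ := fun J hJ => by
    by_contra! hlt
    exact hcon J (T J) hJ hlt (hT J)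
  -- Coordinates and objects are closed off together: A will contain the maximal family `T J` and
  -- the supports of its members for each small J ⊆ A.
  let G : Set I → Set (I ⊕ Ξ) := fun J => Sum.inl '' (⋃ ξ : T J, R ξ) ∪ Sum.inr '' T J
  let F : Set (I ⊕ Ξ) → Set (I ⊕ Ξ) := fun S => G (Sum.inl ⁻¹' S)
  have hF : ∀ S : Set (I ⊕ Ξ), #S ≤ ν → #(F S) ≤ ρ := by
    intro S hS
    have hS' : #(T (Sum.inl ⁻¹' S)) ≤ ρ :=
      hTcard _ ((mk_preimage_of_injective _ _ Sum.inl_injective).trans hS)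
    refine (mk_union_le _ _).trans (add_le_of_le hρ (mk_image_le.trans ?_)
      (mk_image_le.trans hS'))
    calc _ ≤ _ := mk_iUnion_le_sum_mk
      _ ≤ Cardinal.sum fun _ : T (Sum.inl ⁻¹' S) => ν := sum_le_sum _ _ fun ξ => hR ξ
      _ ≤ ρ * ρ := by simpa using mul_le_mul' hS' hν
      _ = ρ := mul_eq_self hρ
  obtain ⟨A, hA, hclosed⟩ := exists_closed_set hρ hνρ F hF
  obtain ⟨η, hη⟩ : ∃ η, Sum.inr η ∉ A := by
    by_contra! hall
    refine hΞ.not_ge (le_trans ?_ hA)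
    exact mk_le_of_injective (f := fun η => (⟨Sum.inr η, hall η⟩ : A)) fun η η' h =>
      Sum.inr_injective (congrArg Subtype.val h)
  -- For ξ in `T J` the support of ξ lies in A, so whatever separates ξ from η lies in J. Maximality
  -- then puts η into `T J`, hence into A.
  let J : Set I := R η ∩ Sum.inl ⁻¹' A
  have hJ : Sum.inl ⁻¹' (Sum.inl '' J : Set (I ⊕ Ξ)) = J :=
    Set.preimage_image_eq _ Sum.inl_injective
  have hsub : F (Sum.inl '' J) ⊆ A := by
    refine hclosed _ ?_ (mk_image_le.trans ((mk_le_mk_of_subset Set.inter_subset_left).trans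
      (hR η)))
    rintro _ ⟨i, hi, rfl⟩
    exact hi.2
  rw [show F (Sum.inl '' J) = G J from congrArg G hJ] at hsub
  refine hη (hsub (Or.inr ⟨η, hTmax J η fun ξ hξ hne => ?_, rfl⟩))
  obtain ⟨i, hi⟩ := hD ξ η hne
  refine ⟨i, ⟨hDR _ _ _ (hsymm _ _ _ hi), ?_⟩, hi⟩
  exact hsub (Or.inl ⟨i, Set.mem_iUnion.2 ⟨⟨ξ, hξ⟩, hDR _ _ _ hi⟩, rfl⟩)

/-! ### Box products -/

section

variable {I : Type u} {X : I → Type u} [∀ i, TopologicalSpace (X i)]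

theorem boxTopology_anti {μ κ : Cardinal.{u}} (h : μ ≤ κ) :
    boxTopology X κ ≤ boxTopology X μ :=
  TopologicalSpace.generateFrom_anti fun _ ⟨U, hU, hc, hB⟩ => ⟨U, hU, hc.trans_le h, hB⟩

theorem isOpen_boxTopology_pi {κ : Cardinal.{u}} {U : ∀ i, Set (X i)} (hU : ∀ i, IsOpen (U i))
    (hI : #I < κ) : IsOpen[boxTopology X κ] (Set.univ.pi U) :=
  TopologicalSpace.isOpen_generateFrom_of_mem ⟨U, hU, (mk_set_le _).trans_lt hI, rfl⟩

theorem IsCellular.exists_boxes {κ : Cardinal.{u}} (hκ : ℵ₀ ≤ κ) {A : Set (Set (∀ i, X i))}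
    (hA : IsCellular (boxTopology X κ) A) :
    ∃ U : A → ∀ i, Set (X i), (∀ ξ i, IsOpen (U ξ i)) ∧ (∀ ξ i, (U ξ i).Nonempty) ∧
      (∀ ξ, #{i | U ξ i ≠ Set.univ} < κ) ∧
      ∀ ξ η, ξ ≠ η → ∃ i, Disjoint (U ξ i) (U η i) := by
  have h : ∀ ξ : A, ∃ U : ∀ i, Set (X i), (∀ i, IsOpen (U i)) ∧
      #{i | U i ≠ Set.univ} < κ ∧ (Set.univ.pi U).Nonempty ∧ Set.univ.pi U ⊆ ξ.1 := by
    intro ξ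
    obtain ⟨x, hx⟩ := (hA.1 _ ξ.2).2
    obtain ⟨_, ⟨U, hU, hUκ, rfl⟩, hxU, hUξ⟩ :=
      @TopologicalSpace.IsTopologicalBasis.exists_subset_of_mem_open _ (boxTopology X κ) _
        (isTopologicalBasis_canonicalBoxes X κ hκ) _ _ hx (hA.1 _ ξ.2).1
    exact ⟨U, hU, hUκ, ⟨x, hxU⟩, hUξ⟩
  choose U hU hUκ hUne hUsub using h
  refine ⟨U, hU, fun ξ => Set.univ_pi_nonempty_iff.1 (hUne ξ), hUκ, fun ξ η hne => ?_⟩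
  exact Set.disjoint_univ_pi.1 ((hA.2 ξ.2 η.2 fun h => hne (Subtype.ext h)).mono
    (hUsub ξ) (hUsub η))

theorem hasCellularFamily_subproduct {Ξ : Type u} {U : Ξ → ∀ i, Set (X i)}
    (hU : ∀ ξ i, IsOpen (U ξ i)) (hne : ∀ ξ i, (U ξ i).Nonempty) {J : Set I}
    {T : Set Ξ} (hT : T.Pairwise fun ξ η => ∃ i ∈ J, Disjoint (U ξ i) (U η i))
    {μ : Cardinal.{u}} (hJ : #J < μ) :
    HasCellularFamily (boxTopology (fun j : J => X j) μ) Set.univ #T := by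
  refine HasCellularFamily.of_pairwise (fun ξ : T => Set.univ.pi fun j : J => U ξ j)
    (fun ξ => isOpen_boxTopology_pi (fun j => hU ξ j) hJ)
    (fun ξ => Set.univ_pi_nonempty_iff.2 fun j => hne ξ j) (fun _ => Set.subset_univ _)
    fun ξ η h => ?_
  obtain ⟨i, hi, hd⟩ := hT ξ.2 η.2 fun h' => h (Subtype.ext h')
  exact Set.disjoint_univ_pi.2 ⟨⟨i, hi⟩, hd⟩

theorem exists_hasCellularFamily_subproduct {α κ : Cardinal.{u}} (hα : 2 ≤ α) (hκ : ℵ₀ ≤ κ)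
    (hακ : α ^< κ < (α ^< κ) ^< κ)
    (hS : Order.succ (α ^< κ) < souslinNumber (boxTopology X κ)) :
    ∃ μ : Cardinal.{u}, ℵ₀ ≤ μ ∧ μ < κ ∧ ∃ J : Set I, #J < μ ∧
      HasCellularFamily (boxTopology (fun j : J => X j) μ) Set.univ (α ^< κ) := by
  set β := α ^< κ with hβ
  have hα0 : α ≠ 0 := (two_pos.trans_le hα).ne'
  have hsing := isSingular_of_powerlt_lt hα hκ hακ
  have hκβ : κ ≤ β := le_powerlt_self hα
  have hκ' : ℵ₀ < κ := hκ.lt_of_ne fun h => not_isSingular_aleph0 (h ▸ hsing)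
  obtain ⟨Γ, c, hΓ, hc, hcof⟩ := hsing.exists_cofinal
  obtain ⟨A, hA, hAcard⟩ := exists_isCellular_of_lt_souslinNumber hS
  obtain ⟨U, hU, hne, hUκ, hdisj⟩ := hA.exists_boxes hκ
  choose γ hγ using fun ξ => hcof _ (hUκ ξ)
  have hβ0 : ℵ₀ ≤ Order.succ β := (hκ.trans hκβ).trans (Order.le_succ β)
  obtain ⟨γ₀, hγ₀⟩ := infinite_pigeonhole_card γ (Order.succ β) hAcard.ge hβ0 (by
    rw [(isRegular_succ (hκ.trans hκβ)).cof_ord]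
    exact (hΓ.trans_le hκβ).trans (Order.lt_succ β))
  set Ξ := γ ⁻¹' {γ₀}
  -- Including `#Γ` keeps the union of the Γ many coordinate sets below at size at most ν.
  let ν := max (c γ₀) (max #Γ ℵ₀)
  have hνκ : ν < κ := max_lt (hc γ₀) (max_lt hΓ hκ')
  have hν0 : ℵ₀ ≤ ν := (le_max_right _ _).trans (le_max_right _ _)
  have hR : ∀ ξ : Ξ, #{i | U ξ.1 i ≠ Set.univ} ≤ ν := fun ξ =>
    (hγ ξ.1).le.trans ((congrArg c ξ.2).le.trans (le_max_left _ _))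
  -- The exponent is at least ν so that `b x ^ ν ≤ b x`.
  let b : Γ → Cardinal.{u} := fun x => α ^ max (c x) ν
  have hb : ∀ x, b x < β := fun x => power_lt_powerlt hκ hακ (max_lt (hc x) hνκ)
  have hbν : ∀ x, b x ^ ν ≤ b x := fun x => by
    simp only [b]
    rw [← power_mul, mul_eq_left (hν0.trans (le_max_right _ _)) (le_max_right _ _)
      (aleph0_pos.trans_le hν0).ne']
  have hmaxb : ∀ x, max (c x) ν ≤ b x := fun x =>
    (cantor _).le.trans (power_le_power_right hα)
  have hsep : ∀ x : Γ, ∃ (J : Set I) (T : Set Ξ), #J ≤ ν ∧ b x < #T ∧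
      T.Pairwise fun ξ η => ∃ i ∈ J, Disjoint (U ξ.1 i) (U η.1 i) := by
    intro x
    refine exists_small_separating_set (fun ξ : Ξ => {i | U ξ.1 i ≠ Set.univ})
      (fun i ξ η => Disjoint (U ξ.1 i) (U η.1 i)) (fun _ _ _ h => h.symm) ?_
      (fun ξ η h => hdisj _ _ fun h' => h (Subtype.ext h'))
      ((hν0.trans (le_max_right _ _)).trans (hmaxb x)) (hbν x) hR
      ((hb x).trans ((Order.lt_succ β).trans_le hγ₀))
    intro i ξ η h huniv
    rw [huniv, Set.univ_disjoint] at h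
    exact (hne η.1 i).ne_empty h
  choose J T hJ hT hpair using hsep
  have hJν : #(⋃ x, J x) ≤ ν :=
    calc #(⋃ x, J x) ≤ _ := mk_iUnion_le_sum_mk
      _ ≤ Cardinal.sum fun _ : Γ => ν := sum_le_sum _ _ hJ
      _ ≤ ν * ν := by
        simpa using mul_le_mul_left ((le_max_left _ _).trans (le_max_right _ _) : #Γ ≤ ν) ν
      _ = ν := mul_eq_self hν0
  have hJlt := Order.lt_succ_iff.2 hJν
  have hbcof : ∀ μ < β, ∃ x, μ < b x := by
    intro μ hμ
    obtain ⟨σ, hσ, hμσ⟩ := exists_lt_power_of_lt_powerlt hμ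
    obtain ⟨x, hx⟩ := hcof σ hσ
    exact ⟨x, hμσ.trans_le (power_le_power_left hα0 (hx.le.trans (le_max_left _ _)))⟩
  refine ⟨Order.succ ν, hν0.trans (Order.le_succ ν), hsing.isSuccLimit.succ_lt hνκ,
    ⋃ x, J x, hJlt, ?_⟩
  refine HasCellularFamily.of_forall_lt (hκ'.trans_le hκβ) (hΓ.trans_le hκβ) hb hbcof ?_
  intro μ hμ
  obtain ⟨x, hx⟩ := hbcof μ hμ
  refine (hasCellularFamily_subproduct (U := fun ξ : Ξ => U ξ.1) (fun ξ => hU ξ.1)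
    (fun ξ => hne ξ.1) (T := T x) ?_ hJlt).mono (hx.trans (hT x)).le
  exact (hpair x).mono' fun ξ η ⟨i, hi, hd⟩ => ⟨i, Set.mem_iUnion.2 ⟨x, hi⟩, hd⟩

end

end

theorem theorem4p41 (α κ : Cardinal.{u}) (hα : 2 ≤ α) (hκ : ℵ₀ ≤ κ)
    (hακ : α ^< κ < (α ^< κ) ^< κ)
    {I : Type u} (X : I → Type u) [∀ i, TopologicalSpace (X i)] [∀ i, Nonempty (X i)] :
    (Order.succ (α ^< κ) < souslinNumber (boxTopology X κ) →
      ∃ μ : Cardinal.{u}, ℵ₀ ≤ μ ∧ μ < κ ∧ ∃ J : Set I, #J < μ ∧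
        Order.succ (α ^< κ) ≤ souslinNumber (boxTopology (fun j : J => X j) μ)) ∧
    ((∀ J : Set I, J.Nonempty → #J < κ →
        souslinNumber (boxTopology (fun j : J => X j) κ) < Order.succ (α ^< κ)) →
      souslinNumber (boxTopology X κ) ≤ Order.succ (α ^< κ)) := by
  constructor
  · intro hS
    obtain ⟨μ, hμ, hμκ, J, hJ, h⟩ := exists_hasCellularFamily_subproduct hα hκ hακ hS
    exact ⟨μ, hμ, hμκ, J, hJ, h.succ_le_souslinNumber⟩
  · intro hsmall
    by_contra! hS
    obtain ⟨μ, -, hμκ, J, hJ, h⟩ := exists_hasCellularFamily_subproduct hα hκ hακ hS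
    -- Over an empty J the product is a single point, which has no infinite cellular family.
    have hne : J.Nonempty := by
      by_contra! hempty
      have : IsEmpty J := Set.isEmpty_coe_sort.2 hempty
      exact (Cardinal.one_lt_aleph0.trans_le (hκ.trans (Cardinal.le_powerlt_self hα))).not_ge h.le_one
    exact (hsmall J hne (hJ.trans hμκ)).not_ge
      (h.of_le (boxTopology_anti hμκ.le)).succ_le_souslinNumber
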